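/- Setting. A seller offers $n$ items to one buyer, whose type is a monotone valuation $v:2^{[n]}\to\mathbb{R}_{\ge 0}$ drawn from a distribution $\mathcal{D}$. A lottery (menu entry) $\lambda=(x,p)$ is a probability distribution $x$ over subsets of $[n]$ together with a price $p\ge 0$. In the buy-many mechanism generated by a (finite or infinite) set $\Lambda$ of lotteries, the buyer follows an adaptive strategy, possibly of unbounded length: having observed the sets $S_1,\dots,S_{i}$ received so far, she stops or buys another lottery from $\Lambda$; lotteries may be bought repeatedly. She receives the union of all sets allocated and pays the sum of all prices, so that the utility of a strategy for type $v$ is $\mathbb{E}[v(\bigcup_i S_i)]-\mathbb{E}[\sum_i p_i]$. Each type uses a utility-maximizing strategy, ties being broken in favour of the seller (a type for which no maximizer exists pays $0$). Let $\mathrm{Rev}_{\mathcal{D}}(\Lambda)\in[0,\infty]$ be the resulting expected payment for $v\sim\mathcal{D}$, where, if the payment is not measurable as a function of $v$, the expectation is the lower integral, and let $\mathrm{BuyManyRev}(\mathcal{D})=\sup_{\Lambda}\mathrm{Rev}_{\mathcal{D}}(\Lambda)$, the supremum being over all sets of lotteries. Theorem. There is an absolute constant $C>0$ such that for every $n\ge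 0$, every $\epsilon\in(0,1)$ and every probability distribution $\mathcal{D}$ over monotone valuations on $n$ items the following holds. (i) If $\mathrm{BuyManyRev}(\mathcal{D})<\infty$, then there is a finite set $\Lambda$ of at most $C\,(16\cdot 2^n)^{6\cdot 2^n}\epsilon^{-12\cdot 2^n}$ lotteries with $$\mathrm{Rev}_{\mathcal{D}}(\Lambda)\ \ge\ (1-\epsilon)\,\mathrm{BuyManyRev}(\mathcal{D}).$$ (ii) If $\mathrm{BuyManyRev}(\mathcal{D})=\infty$, then for every real $r\ge 0$ there is a finite set $\Lambda$ of at most $C\,(16\cdot 2^n)^{6\cdot 2^n}\epsilon^{-12\cdot 2^n}$ lotteries with $\mathrm{Rev}_{\mathcal{D}}(\Lambda)\ge r$. -/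

import Mathlib

open MeasureTheory
open scoped NNReal ENNReal

noncomputable section

namespace BuyMany

/-- A valuation function on the subsets of the items `Fin n`: nonnegative and monotone. Valuations
carry the Borel σ-algebra inherited from `Finset (Fin n) → ℝ≥0`. -/
abbrev Valuation (n : ℕ) : Type :=
  {v : Finset (Fin n) → ℝ≥0 // Monotone v}

/-- A lottery (menu entry): a probability distribution over sets of items, and a price. -/
structure Lottery (n : ℕ) where
  /-- the probability that exactly the set `S` is allocated -/
  prob : Finset (Fin n) → ℝ≥0
  sum_prob : ∑ S, prob S = 1
  /-- the price charged -/
  price : ℝ≥0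

/-- An adaptive purchasing strategy. Given the list of the sets received so far (latest first),
it either stops (`none`) or names the lottery to be purchased next. -/
abbrev Strategy (n : ℕ) : Type :=
  List (Finset (Fin n)) → Option (Lottery n)

/-- The strategy purchases only lotteries of the menu `L`. -/
def Strategy.BuysFrom {n : ℕ} (σ : Strategy n) (L : Set (Lottery n)) : Prop :=
  ∀ h l, σ h = some l → l ∈ L

/-- The union of all sets received. -/
def owned {n : ℕ} (h : List (Finset (Fin n))) : Finset (Fin n) :=
  h.foldr (fun S U => S ∪ U) ∅

/-- Expected value, under `v`, of the set owned at the end, when the buyer starts with history `h`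
and follows `σ` for at most `k` further purchases. -/
def Strategy.valueFrom {n : ℕ} (v : Valuation n) (σ : Strategy n) :
    ℕ → List (Finset (Fin n)) → ℝ≥0
  | 0, h => v.1 (owned h)
  | k + 1, h =>
    match σ h with
    | none => v.1 (owned h)
    | some l => ∑ S, l.prob S * Strategy.valueFrom v σ k (S :: h)

/-- Expected sum of the prices paid, when the buyer starts with history `h` and follows `σ` for at
most `k` further purchases. -/
def Strategy.paymentFrom {n : ℕ} (σ : Strategy n) :
    ℕ → List (Finset (Fin n)) → ℝ≥0
  | 0, _ => 0
  | k + 1, h =>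
    match σ h with
    | none => 0
    | some l => l.price + ∑ S, l.prob S * Strategy.paymentFrom σ k (S :: h)

/-- `𝔼[v(⋃ᵢ Sᵢ)]` for the whole, possibly unbounded, random sequence of purchases. As `v` is
monotone, the expectations over the first `k` purchases increase to it. -/
def Strategy.value {n : ℕ} (v : Valuation n) (σ : Strategy n) : ℝ≥0∞ :=
  ⨆ k : ℕ, (σ.valueFrom v k [] : ℝ≥0∞)

/-- The expected total payment `𝔼[∑ᵢ pᵢ]` for the whole, possibly unbounded, random sequence of
purchases; it may be infinite. -/
def Strategy.payment {n : ℕ} (σ : Strategy n) : ℝ≥0∞ :=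
  ⨆ k : ℕ, (σ.paymentFrom k [] : ℝ≥0∞)

/-- Quasi-linear utility of a strategy; it is `⊥` if the expected payment is infinite (the expected
value is always finite). -/
def Strategy.utility {n : ℕ} (v : Valuation n) (σ : Strategy n) : EReal :=
  (σ.value v : EReal) - (σ.payment : EReal)

/-- `σ` is a best response of a buyer of type `v` to the buy-many mechanism generated by `L`. -/
def IsOptimal {n : ℕ} (L : Set (Lottery n)) (v : Valuation n) (σ : Strategy n) : Prop :=
  σ.BuysFrom L ∧ ∀ τ : Strategy n, τ.BuysFrom L → τ.utility v ≤ σ.utility v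

/-- Payment of a buyer of type `v` in the buy-many mechanism generated by `L`, ties among the best
responses being broken in favour of the seller (a type without a best response pays nothing). -/
def revAt {n : ℕ} (L : Set (Lottery n)) (v : Valuation n) : ℝ≥0∞ :=
  ⨆ (σ : Strategy n) (_ : IsOptimal L v σ), σ.payment

/-- Expected revenue of the buy-many mechanism generated by `L` for the type distribution `D`. -/
def rev {n : ℕ} (D : Measure (Valuation n)) (L : Set (Lottery n)) : ℝ≥0∞ :=
  ∫⁻ v, revAt L v ∂D

/-- The optimal revenue of buy-many mechanisms, generated by arbitrary, possibly infinite, sets of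
lotteries. -/
def buyManyRev {n : ℕ} (D : Measure (Valuation n)) : ℝ≥0∞ :=
  ⨆ L : Set (Lottery n), rev D L

end BuyMany

end

namespace BuyMany

variable {n : ℕ}

/-! Call a function `f` of the owned set excessive for a menu with factor `c` if no entry raises `f`
by more than `c` times its price on average. Then `f` of the owned set minus `c` times the amount
paid is a supermartingale, so if `f ≥ v`, every strategy has value at most `f ∅ + c * payment`
(`IsExcessive.value_le`). The optimal continuation utility `best L v` is monotone, dominates `v` and
is excessive with factor 1, and an optimal strategy has value at least `best L v ∅ + payment`
(`IsOptimal.best_le`).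

Suppose a finite menu `G` satisfies: monotone functions excessive for `L` with factor 1 are so for
`G`, and excessiveness for `G` implies that for `L` with the factor enlarged by `1 + d`. Sell `G` at
prices multiplied by `1 - b`. Bounding the optimal value under each menu by the `best` of the other
and adding, the `best` terms cancel and the payments `P` (menu `L`) and `P'` (new menu) satisfy `(1
- (1 - b) * (1 + d)) * P ≤ b / (1 - b) * P'`. This holds type by type, so integration finishes the
proof.

To build `G`, note that excessiveness sees only the ratios of probabilities to price. Measuring each
ratio in units of `(cost L S)⁻¹`, the entries of `L` become vectors in a unit cube. `G` consists of
the grid points of mesh `1 / K` that do not improve upon `L`, plus free entries for sets of cost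
zero. Rounding down loses at most `1 / K` per set, so `d = 2 ^ n / K` (`IsExcessive.of_gridMenu`).
-/

theorem owned_nil : owned ([] : List (Finset (Fin n))) = ∅ := rfl

theorem Lottery.sum_coe_prob (l : Lottery n) : ∑ S, (l.prob S : ℝ) = 1 := by
  exact_mod_cast congrArg ((↑) : ℝ≥0 → ℝ) l.sum_prob

theorem Lottery.sum_prob_mul_le (l : Lottery n) {f : Finset (Fin n) → ℝ≥0} {M : ℝ≥0}
    (hf : ∀ S, f S ≤ M) : ∑ S, l.prob S * f S ≤ M :=
  calc ∑ S, l.prob S * f S ≤ ∑ S, l.prob S * M :=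
        Finset.sum_le_sum fun S _ => mul_le_mul_right (hf S) _
    _ = M := by rw [← Finset.sum_mul, l.sum_prob, one_mul]

/-! ### Truncated values and payments of a strategy, and their limits -/

namespace Strategy

theorem valueFrom_none {v : Valuation n} {σ : Strategy n} {h : List (Finset (Fin n))}
    (hσ : σ h = none) (k : ℕ) : σ.valueFrom v k h = v.1 (owned h) := by
  cases k <;> simp [valueFrom, hσ]

theorem valueFrom_some {v : Valuation n} {σ : Strategy n} {h : List (Finset (Fin n))}
    {l : Lottery n} (hσ : σ h = some l) (k : ℕ) :
    σ.valueFrom v (k + 1) h = ∑ S, l.prob S * σ.valueFrom v k (S :: h) := by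
  simp [valueFrom, hσ]

theorem paymentFrom_none {σ : Strategy n} {h : List (Finset (Fin n))}
    (hσ : σ h = none) (k : ℕ) : σ.paymentFrom k h = 0 := by
  cases k <;> simp [paymentFrom, hσ]

theorem paymentFrom_some {σ : Strategy n} {h : List (Finset (Fin n))}
    {l : Lottery n} (hσ : σ h = some l) (k : ℕ) :
    σ.paymentFrom (k + 1) h = l.price + ∑ S, l.prob S * σ.paymentFrom k (S :: h) := by
  simp [paymentFrom, hσ]

theorem valueFrom_le (v : Valuation n) (σ : Strategy n) (k : ℕ) (h : List (Finset (Fin n))) :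
    σ.valueFrom v k h ≤ v.1 Finset.univ := by
  induction k generalizing h with
  | zero => exact v.2 (Finset.subset_univ _)
  | succ k ih =>
    cases hσ : σ h with
    | none => rw [valueFrom_none hσ]; exact v.2 (Finset.subset_univ _)
    | some l => rw [valueFrom_some hσ]; exact l.sum_prob_mul_le fun S => ih _

theorem paymentFrom_mono (σ : Strategy n) (h : List (Finset (Fin n))) :
    Monotone fun k => σ.paymentFrom k h := by
  refine monotone_nat_of_le_succ fun k => ?_
  induction k generalizing h with
  | zero => exact zero_le
  | succ k ih =>
    cases hσ : σ h with
    | none => simp [paymentFrom_none hσ]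
    | some l =>
      simp only [paymentFrom_some hσ]
      gcongr
      exact ih _

theorem value_le (v : Valuation n) (σ : Strategy n) : σ.value v ≤ v.1 Finset.univ :=
  iSup_le fun k => by exact_mod_cast σ.valueFrom_le v k []

theorem value_ne_top (v : Valuation n) (σ : Strategy n) : σ.value v ≠ ⊤ :=
  ne_top_of_le_ne_top ENNReal.coe_ne_top (σ.value_le v)

theorem valueFrom_le_toReal_value (v : Valuation n) (σ : Strategy n) (k : ℕ) :
    (σ.valueFrom v k [] : ℝ) ≤ (σ.value v).toReal := by
  have := ENNReal.toReal_mono (σ.value_ne_top v)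
    (le_iSup (fun k => (σ.valueFrom v k [] : ℝ≥0∞)) k)
  simpa using this

theorem paymentFrom_le_toReal_payment {σ : Strategy n} (hσ : σ.payment ≠ ⊤) (k : ℕ) :
    (σ.paymentFrom k [] : ℝ) ≤ σ.payment.toReal := by
  have := ENNReal.toReal_mono hσ (le_iSup (fun k => (σ.paymentFrom k [] : ℝ≥0∞)) k)
  simpa using this

theorem toReal_value_le {v : Valuation n} {σ : Strategy n} {a : ℝ}
    (ha : ∀ k, (σ.valueFrom v k [] : ℝ) ≤ a) : (σ.value v).toReal ≤ a := by
  refine ENNReal.toReal_le_of_le_ofReal ((NNReal.coe_nonneg _).trans (ha 0)) (iSup_le fun k => ?_)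
  rw [← ENNReal.ofReal_coe_nnreal]
  exact ENNReal.ofReal_le_ofReal (ha k)

theorem payment_le_ofReal {σ : Strategy n} {a : ℝ}
    (ha : ∀ k, (σ.paymentFrom k [] : ℝ) ≤ a) : σ.payment ≤ ENNReal.ofReal a := by
  refine iSup_le fun k => ?_
  rw [← ENNReal.ofReal_coe_nnreal]
  exact ENNReal.ofReal_le_ofReal (ha k)

theorem utility_eq {σ : Strategy n} (v : Valuation n) (hσ : σ.payment ≠ ⊤) :
    σ.utility v = (((σ.value v).toReal - σ.payment.toReal : ℝ) : EReal) := by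
  unfold utility
  have hv := σ.value_ne_top v
  generalize σ.value v = a at *
  generalize σ.payment = b at *
  lift a to ℝ≥0 using hv
  lift b to ℝ≥0 using hσ
  simp only [ENNReal.coe_toReal, EReal.coe_sub]
  rfl

theorem utility_of_payment_eq_top {σ : Strategy n} (v : Valuation n) (hσ : σ.payment = ⊤) :
    σ.utility v = ⊥ := by
  simp [utility, hσ]

end Strategy

/-! ### Excessive functions and the supermartingale bound -/

/-- `f` is excessive for the menu `L`, with prices multiplied by `c`: buying one more lottery
does not increase `f` by more than its price on average. -/
def IsExcessive (L : Set (Lottery n)) (c : ℝ) (f : Finset (Fin n) → ℝ) : Prop :=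
  ∀ l ∈ L, ∀ U, ∑ S, (l.prob S : ℝ) * f (S ∪ U) ≤ f U + c * l.price

/-- Optional stopping: each purchase raises the mean of `f` by at most `c` times the price, and `f`
dominates `v` wherever the buyer stops. A factor `c ≠ 1` allows `f` to come from a different menu.
-/
theorem IsExcessive.valueFrom_le {L : Set (Lottery n)} {c : ℝ} {f : Finset (Fin n) → ℝ}
    (hf : IsExcessive L c f) {v : Valuation n} (hv : ∀ U, (v.1 U : ℝ) ≤ f U) {σ : Strategy n}
    (hσ : σ.BuysFrom L) (k : ℕ) (h : List (Finset (Fin n))) :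
    (σ.valueFrom v k h : ℝ) ≤ f (owned h) + c * σ.paymentFrom k h := by
  induction k generalizing h with
  | zero => simpa [Strategy.valueFrom, Strategy.paymentFrom] using hv _
  | succ k ih =>
    cases hl : σ h with
    | none =>
      rw [Strategy.valueFrom_none hl, Strategy.paymentFrom_none hl]
      simpa using hv _
    | some l =>
      rw [Strategy.valueFrom_some hl, Strategy.paymentFrom_some hl]
      push_cast
      calc ∑ S, (l.prob S : ℝ) * (σ.valueFrom v k (S :: h) : ℝ)
          ≤ ∑ S, (l.prob S : ℝ) * (f (S ∪ owned h) + c * σ.paymentFrom k (S :: h)) :=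
            Finset.sum_le_sum fun S _ => mul_le_mul_of_nonneg_left (ih (S :: h)) (by positivity)
        _ = ∑ S, (l.prob S : ℝ) * f (S ∪ owned h)
            + c * ∑ S, (l.prob S : ℝ) * σ.paymentFrom k (S :: h) := by
          rw [Finset.mul_sum, ← Finset.sum_add_distrib]
          exact Finset.sum_congr rfl fun S _ => by ring
        _ ≤ _ := by linarith [hf l (hσ h l hl) (owned h)]

theorem IsExcessive.value_le {L : Set (Lottery n)} {c : ℝ} (hc : 0 ≤ c)
    {f : Finset (Fin n) → ℝ}
    (hf : IsExcessive L c f) {v : Valuation n} (hv : ∀ U, (v.1 U : ℝ) ≤ f U) {σ : Strategy n}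
    (hσ : σ.BuysFrom L) (hp : σ.payment ≠ ⊤) :
    (σ.value v).toReal ≤ f ∅ + c * σ.payment.toReal :=
  Strategy.toReal_value_le fun k => (hf.valueFrom_le hv hσ k []).trans <|
    add_le_add le_rfl <|
      mul_le_mul_of_nonneg_left (Strategy.paymentFrom_le_toReal_payment hp k) hc

/-! ### The optimal continuation utility of a menu -/

/-- The supremum of the utilities of a buyer of type `v` who owns `U` and purchases at most `k`
further lotteries of the menu `L`. -/
noncomputable def bestWithin (L : Set (Lottery n)) (v : Valuation n) :
    ℕ → Finset (Fin n) → ℝ≥0∞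
  | 0, U => v.1 U
  | k + 1, U =>
    v.1 U ⊔ ⨆ l ∈ L, (∑ S, (l.prob S : ℝ≥0∞) * bestWithin L v k (S ∪ U)) - l.price

/-- The supremum of the utilities of a buyer of type `v` who owns `U` and faces the menu `L`. -/
noncomputable def best (L : Set (Lottery n)) (v : Valuation n) (U : Finset (Fin n)) : ℝ≥0∞ :=
  ⨆ k, bestWithin L v k U

section Best

variable (L : Set (Lottery n)) (v : Valuation n)

theorem Lottery.sum_ennreal_prob (l : Lottery n) : ∑ S, (l.prob S : ℝ≥0∞) = 1 := by
  exact_mod_cast congrArg ((↑) : ℝ≥0 → ℝ≥0∞) l.sum_prob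

theorem bestWithin_le (k : ℕ) (U : Finset (Fin n)) : bestWithin L v k U ≤ v.1 Finset.univ := by
  induction k generalizing U with
  | zero => exact ENNReal.coe_le_coe.2 (v.2 (Finset.subset_univ _))
  | succ k ih =>
    refine sup_le (ENNReal.coe_le_coe.2 (v.2 (Finset.subset_univ _))) (iSup₂_le fun l _ => ?_)
    refine tsub_le_self.trans ?_
    calc ∑ S, (l.prob S : ℝ≥0∞) * bestWithin L v k (S ∪ U)
        ≤ ∑ S, (l.prob S : ℝ≥0∞) * v.1 Finset.univ :=
          Finset.sum_le_sum fun S _ => mul_le_mul_right (ih _) _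
      _ = _ := by rw [← Finset.sum_mul, l.sum_ennreal_prob, one_mul]

theorem coe_le_bestWithin (k : ℕ) (U : Finset (Fin n)) : (v.1 U : ℝ≥0∞) ≤ bestWithin L v k U := by
  cases k with
  | zero => exact le_rfl
  | succ k => exact le_sup_left

theorem bestWithin_mono_left (U : Finset (Fin n)) : Monotone fun k => bestWithin L v k U := by
  refine monotone_nat_of_le_succ fun k => ?_
  induction k generalizing U with
  | zero => exact coe_le_bestWithin L v 1 U
  | succ k ih =>
    refine sup_le_sup le_rfl (iSup₂_mono fun l _ => tsub_le_tsub_right ?_ _)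
    exact Finset.sum_le_sum fun S _ => mul_le_mul_right (ih _) _

theorem bestWithin_mono (k : ℕ) : Monotone (bestWithin L v k) := by
  induction k with
  | zero => exact fun U U' h => ENNReal.coe_le_coe.2 (v.2 h)
  | succ k ih =>
    intro U U' h
    refine sup_le_sup (ENNReal.coe_le_coe.2 (v.2 h))
      (iSup₂_mono fun l _ => tsub_le_tsub_right ?_ _)
    exact Finset.sum_le_sum fun S _ => mul_le_mul_right (ih (Finset.union_subset_union_right h)) _

theorem best_ne_top (U : Finset (Fin n)) : best L v U ≠ ⊤ :=
  ne_top_of_le_ne_top ENNReal.coe_ne_top (iSup_le fun k => bestWithin_le L v k U)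

theorem best_mono : Monotone (best L v) := fun _ _ h =>
  iSup_mono fun k => bestWithin_mono L v k h

theorem toReal_best_mono : Monotone fun U => (best L v U).toReal := fun _ _ h =>
  ENNReal.toReal_mono (best_ne_top L v _) (best_mono L v h)

theorem coe_le_toReal_best (U : Finset (Fin n)) : (v.1 U : ℝ) ≤ (best L v U).toReal := by
  simpa [bestWithin] using
    ENNReal.toReal_mono (best_ne_top L v U) (le_iSup (fun k => bestWithin L v k U) 0)

/-- Buying `l` first turns horizon `k` into `k + 1`; as `bestWithin` increases with the horizon, the
supremum passes through the finite expectation. -/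
theorem sum_mul_best_le {l : Lottery n} (hl : l ∈ L) (U : Finset (Fin n)) :
    ∑ S, (l.prob S : ℝ≥0∞) * best L v (S ∪ U) ≤ best L v U + l.price := by
  simp only [best, ENNReal.mul_iSup]
  rw [ENNReal.finsetSum_iSup_of_monotone]
  · refine iSup_le fun k => ?_
    rw [← tsub_le_iff_right]
    refine le_trans ?_ (le_iSup (fun k => bestWithin L v k U) (k + 1))
    exact le_sup_of_le_right (le_iSup₂_of_le l hl le_rfl)
  · exact fun S i j h => mul_le_mul_right (bestWithin_mono_left L v _ h) _

theorem toReal_sum_mul_best (l : Lottery n) (U : Finset (Fin n)) :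
    (∑ S, (l.prob S : ℝ≥0∞) * best L v (S ∪ U)).toReal
      = ∑ S, (l.prob S : ℝ) * (best L v (S ∪ U)).toReal := by
  rw [ENNReal.toReal_sum fun S _ => ENNReal.mul_ne_top ENNReal.coe_ne_top (best_ne_top L v _)]
  simp

theorem isExcessive_best : IsExcessive L 1 fun U => (best L v U).toReal := by
  intro l hl U
  have := ENNReal.toReal_mono (by simp [best_ne_top]) (sum_mul_best_le L v hl U)
  rw [toReal_sum_mul_best, ENNReal.toReal_add (best_ne_top L v U) ENNReal.coe_ne_top] at this
  simpa using this

theorem exists_near_best_step {η : ℝ≥0} (hη : 0 < η) (k : ℕ) (U : Finset (Fin n)) :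
    ∃ o : Option (Lottery n), (∀ l ∈ o, l ∈ L) ∧
      (o = none → bestWithin L v (k + 1) U ≤ v.1 U) ∧
      (∀ l ∈ o, bestWithin L v (k + 1) U + l.price
        ≤ ∑ S, (l.prob S : ℝ≥0∞) * bestWithin L v k (S ∪ U) + η) := by
  by_cases h : bestWithin L v (k + 1) U ≤ v.1 U
  · exact ⟨none, by simp, fun _ => h, by simp⟩
  have hne : bestWithin L v (k + 1) U ≠ ⊤ :=
    ne_top_of_le_ne_top ENNReal.coe_ne_top (bestWithin_le L v (k + 1) U)
  have hlt : bestWithin L v (k + 1) U - η < bestWithin L v (k + 1) U :=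
    ENNReal.sub_lt_self hne (ne_bot_of_gt (not_le.1 h)) (by simpa using hη.ne')
  have hlt' : max (bestWithin L v (k + 1) U - η) (v.1 U) < bestWithin L v (k + 1) U :=
    max_lt hlt (not_le.1 h)
  conv_rhs at hlt' => rw [bestWithin]
  rcases lt_sup_iff.1 hlt' with h' | h'
  · exact absurd h' (not_lt.2 (le_max_right _ _))
  simp only [lt_iSup_iff] at h'
  obtain ⟨l, hl, h'⟩ := h'
  refine ⟨some l, by simpa using hl, by simp, ?_⟩
  simp only [Option.mem_def, Option.some.injEq, forall_eq']
  have h1 := ((le_max_left _ _).trans_lt h').le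
  -- The truncated difference is positive, hence a genuine one, and the price can be added back.
  have h2 : (l.price : ℝ≥0∞) ≤ ∑ S, (l.prob S : ℝ≥0∞) * bestWithin L v k (S ∪ U) :=
    (tsub_pos_iff_lt.1 (bot_le.trans_lt h')).le
  rw [tsub_le_iff_right] at h1
  calc bestWithin L v (k + 1) U + l.price
      ≤ (∑ S, (l.prob S : ℝ≥0∞) * bestWithin L v k (S ∪ U) - l.price + η) + l.price := by gcongr
    _ = (∑ S, (l.prob S : ℝ≥0∞) * bestWithin L v k (S ∪ U) - l.price + l.price) + η := by ring
    _ = _ := by rw [tsub_add_cancel_of_le h2]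

/-- Backward induction: the history's length tells how many purchases remain, and each one loses at
most `η`. -/
theorem exists_near_bestWithin {η : ℝ≥0} (hη : 0 < η) (k : ℕ) :
    ∃ τ : Strategy n, τ.BuysFrom L ∧
      bestWithin L v k ∅ + τ.payment ≤ τ.value v + k * η := by
  choose act hmem hnone hsome using exists_near_best_step L v hη
  let τ : Strategy n := fun h =>
    match k - h.length with
    | 0 => none
    | j + 1 => act j (owned h)
  have τ_stop : ∀ h : List (Finset (Fin n)), k ≤ h.length → τ h = none := fun h hh => by
    simp only [τ, Nat.sub_eq_zero_of_le hh]
  have τ_act : ∀ (h : List (Finset (Fin n))) (j : ℕ), h.length + (j + 1) = k →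
      τ h = act j (owned h) := fun h j hh => by
    have : k - h.length = j + 1 := by omega
    simp only [τ, this]
  have hbuys : τ.BuysFrom L := by
    intro h l hl
    rcases le_or_gt k h.length with hk | hk
    · simp [τ_stop h hk] at hl
    · obtain ⟨j, hj⟩ : ∃ j, h.length + (j + 1) = k := ⟨k - h.length - 1, by omega⟩
      rw [τ_act h j hj] at hl
      exact hmem j _ l hl
  -- The strategy stops after `k` purchases, so its total payment is already reached at horizon `k`.
  have hpay : ∀ (m j : ℕ) (h : List (Finset (Fin n))), k ≤ h.length + j →
      τ.paymentFrom m h ≤ τ.paymentFrom j h := by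
    intro m
    induction m with
    | zero => exact fun j h _ => zero_le
    | succ m ih =>
      intro j h hj
      cases hl : τ h with
      | none => simp [Strategy.paymentFrom_none hl]
      | some l =>
        cases j with
        | zero => simp [τ_stop h (by simpa using hj)] at hl
        | succ j =>
          rw [Strategy.paymentFrom_some hl, Strategy.paymentFrom_some hl]
          gcongr with S
          exact ih j (S :: h) (by simp only [List.length_cons]; omega)
  have hmain : ∀ (j : ℕ) (h : List (Finset (Fin n))), h.length + j = k →
      bestWithin L v j (owned h) + τ.paymentFrom j h
        ≤ (τ.valueFrom v j h : ℝ≥0∞) + j * η := by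
    intro j
    induction j with
    | zero => intro h _; simp [Strategy.valueFrom, Strategy.paymentFrom, bestWithin]
    | succ j ih =>
      intro h hj
      have hact := τ_act h j hj
      cases hl : τ h with
      | none =>
        rw [Strategy.valueFrom_none hl, Strategy.paymentFrom_none hl]
        rw [hl] at hact
        simpa using le_add_right (hnone j _ hact.symm)
      | some l =>
        rw [Strategy.valueFrom_some hl, Strategy.paymentFrom_some hl]
        have hs := hsome j (owned h) l (by rw [← hact, hl]; rfl)
        push_cast
        calc bestWithin L v (j + 1) (owned h)
              + (l.price + ∑ S, (l.prob S : ℝ≥0∞) * τ.paymentFrom j (S :: h))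
            = (bestWithin L v (j + 1) (owned h) + l.price)
              + ∑ S, (l.prob S : ℝ≥0∞) * τ.paymentFrom j (S :: h) := by ring
          _ ≤ (∑ S, (l.prob S : ℝ≥0∞) * bestWithin L v j (S ∪ owned h) + η)
              + ∑ S, (l.prob S : ℝ≥0∞) * τ.paymentFrom j (S :: h) := by gcongr
          _ = ∑ S, (l.prob S : ℝ≥0∞)
                * (bestWithin L v j (S ∪ owned h) + τ.paymentFrom j (S :: h)) + η := by
              simp only [mul_add, Finset.sum_add_distrib]; ring
          _ ≤ ∑ S, (l.prob S : ℝ≥0∞) * (τ.valueFrom v j (S :: h) + j * η) + η := by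
              refine add_le_add (Finset.sum_le_sum fun S _ => mul_le_mul_right ?_ _) le_rfl
              exact ih (S :: h) (by simp only [List.length_cons]; omega)
          _ = _ := by
              simp only [mul_add, Finset.sum_add_distrib]
              rw [← Finset.sum_mul, l.sum_ennreal_prob]; ring
  refine ⟨τ, hbuys, ?_⟩
  have hp : τ.payment ≤ τ.paymentFrom k [] :=
    iSup_le fun m => ENNReal.coe_le_coe.2 (hpay m k [] (by simp))
  calc bestWithin L v k ∅ + τ.payment ≤ bestWithin L v k ∅ + τ.paymentFrom k [] := by gcongr
    _ ≤ (τ.valueFrom v k [] : ℝ≥0∞) + k * η := hmain k [] (by simp)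
    _ ≤ τ.value v + k * η := by
      gcongr
      exact le_iSup (fun k => (τ.valueFrom v k [] : ℝ≥0∞)) k

theorem exists_near_best {η : ℝ} (hη : 0 < η) :
    ∃ τ : Strategy n, τ.BuysFrom L ∧ τ.payment ≠ ⊤ ∧
      (best L v ∅).toReal + τ.payment.toReal ≤ (τ.value v).toReal + η := by
  obtain ⟨k, hk⟩ : ∃ k, (best L v ∅).toReal ≤ (bestWithin L v k ∅).toReal + η / 2 := by
    by_contra! hcon
    have : best L v ∅ ≤ ENNReal.ofReal ((best L v ∅).toReal - η / 2) := by
      refine iSup_le fun k => ?_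
      rw [ENNReal.le_ofReal_iff_toReal_le
        (ne_top_of_le_ne_top ENNReal.coe_ne_top (bestWithin_le L v k ∅))]
      · linarith [hcon k]
      · linarith [hcon k, ENNReal.toReal_nonneg (a := bestWithin L v k ∅)]
    have h2 := ENNReal.toReal_mono ENNReal.ofReal_ne_top this
    rw [ENNReal.toReal_ofReal] at h2
    · linarith
    · linarith [hcon 0, ENNReal.toReal_nonneg (a := bestWithin L v 0 ∅)]
  have hk0 : (0 : ℝ) < k + 1 := by positivity
  obtain ⟨τ, hτ, h⟩ := exists_near_bestWithin L v (η := (η / 2 / (k + 1)).toNNReal)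
    (Real.toNNReal_pos.2 (by positivity)) k
  have hne : (k : ℝ≥0∞) * ((η / 2 / (k + 1)).toNNReal : ℝ≥0∞) ≠ ⊤ :=
    ENNReal.mul_ne_top (ENNReal.natCast_ne_top k) ENNReal.coe_ne_top
  have hb : bestWithin L v k ∅ ≠ ⊤ :=
    ne_top_of_le_ne_top ENNReal.coe_ne_top (bestWithin_le L v k ∅)
  have hr : τ.value v + (k : ℝ≥0∞) * ((η / 2 / (k + 1)).toNNReal : ℝ≥0∞) ≠ ⊤ :=
    ENNReal.add_ne_top.2 ⟨τ.value_ne_top v, hne⟩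
  have hp : τ.payment ≠ ⊤ := ne_top_of_le_ne_top hr (le_add_self.trans h)
  refine ⟨τ, hτ, hp, ?_⟩
  have h2 := ENNReal.toReal_mono hr h
  rw [ENNReal.toReal_add hb hp, ENNReal.toReal_add (τ.value_ne_top v) hne, ENNReal.toReal_mul,
    ENNReal.toReal_natCast, ENNReal.coe_toReal, Real.coe_toNNReal _ (by positivity)] at h2
  have h3 : (k : ℝ) * (η / 2 / (k + 1)) ≤ η / 2 := by
    rw [mul_div_assoc', div_le_iff₀ hk0]; nlinarith
  linarith

variable {L v}

theorem IsOptimal.payment_ne_top {σ : Strategy n} (hσ : IsOptimal L v σ) : σ.payment ≠ ⊤ := by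
  intro h
  obtain ⟨τ, hτ, hp, -⟩ := exists_near_best L v one_pos
  have := hσ.2 τ hτ
  rw [σ.utility_of_payment_eq_top v h, τ.utility_eq v hp] at this
  exact EReal.coe_ne_bot _ (le_bot_iff.1 this)

theorem IsOptimal.best_le {σ : Strategy n} (hσ : IsOptimal L v σ) :
    (best L v ∅).toReal + σ.payment.toReal ≤ (σ.value v).toReal := by
  refine le_of_forall_pos_le_add fun η hη => ?_
  obtain ⟨τ, hτ, hp, h⟩ := exists_near_best L v hη
  have := hσ.2 τ hτ
  rw [σ.utility_eq v hσ.payment_ne_top, τ.utility_eq v hp, EReal.coe_le_coe_iff] at this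
  linarith

theorem isOptimal_of_best_le {σ : Strategy n} (hσ : σ.BuysFrom L) (hp : σ.payment ≠ ⊤)
    (h : (best L v ∅).toReal + σ.payment.toReal ≤ (σ.value v).toReal) : IsOptimal L v σ := by
  refine ⟨hσ, fun τ hτ => ?_⟩
  by_cases hpτ : τ.payment = ⊤
  · rw [τ.utility_of_payment_eq_top v hpτ]; exact bot_le
  rw [σ.utility_eq v hp, τ.utility_eq v hpτ, EReal.coe_le_coe_iff]
  have := (isExcessive_best L v).value_le zero_le_one (coe_le_toReal_best L v) hτ hpτ
  linarith

end Best

/-! ### Existence of best responses to finite menus -/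

/-- The probability that the lottery `l` allocates an item outside `U`. -/
def Lottery.progress (l : Lottery n) (U : Finset (Fin n)) : ℝ :=
  ∑ S with ¬ S ⊆ U, (l.prob S : ℝ)

theorem Lottery.progress_nonneg (l : Lottery n) (U : Finset (Fin n)) : 0 ≤ l.progress U :=
  Finset.sum_nonneg fun _ _ => NNReal.coe_nonneg _

theorem Lottery.subset_of_progress_eq_zero {l : Lottery n} {U S : Finset (Fin n)}
    (h : l.progress U = 0) (hS : l.prob S ≠ 0) : S ⊆ U := by
  by_contra hSU
  rw [progress, Finset.sum_eq_zero_iff_of_nonneg fun _ _ => NNReal.coe_nonneg _] at h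
  exact hS (by simpa using h S (by simpa using hSU))

/-- The probability that a buyer who owns `U` and purchases the lottery `act V` whenever she owns
`V` does not stop within `k` purchases. -/
noncomputable def survival (act : Finset (Fin n) → Option (Lottery n)) :
    ℕ → Finset (Fin n) → ℝ
  | 0, _ => 1
  | k + 1, U => (act U).elim 0 fun l => ∑ S, (l.prob S : ℝ) * survival act k (S ∪ U)

theorem survival_le_one (act : Finset (Fin n) → Option (Lottery n)) (k : ℕ)
    (U : Finset (Fin n)) : survival act k U ≤ 1 := by
  induction k generalizing U with
  | zero => exact le_rfl
  | succ k ih =>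
    rw [survival]
    cases act U with
    | none => exact zero_le_one
    | some l =>
      calc ∑ S, (l.prob S : ℝ) * survival act k (S ∪ U) ≤ ∑ S, (l.prob S : ℝ) * 1 :=
            Finset.sum_le_sum fun S _ => mul_le_mul_of_nonneg_left (ih _) (NNReal.coe_nonneg _)
        _ = 1 := by simp only [mul_one, l.sum_coe_prob]

/-- Every purchase enlarges the owned set with probability at least `q`, so the expected number of
purchases from `U` is at most `t U`, the number of missing items over `q`. Markov's inequality gives
the bound. -/
theorem exists_mul_survival_le {act : Finset (Fin n) → Option (Lottery n)}
    (hact : ∀ U, ∀ l ∈ act U, 0 < l.progress U) :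
    ∃ T : ℝ, ∀ k : ℕ, k * survival act k ∅ ≤ T := by
  obtain ⟨q, hq0, hq⟩ : ∃ q : ℝ, 0 < q ∧ ∀ U, ∀ l ∈ act U, q ≤ l.progress U := by
    obtain ⟨U₀, hU₀⟩ := Finite.exists_min fun U => (act U).elim 1 fun l => l.progress U
    refine ⟨_, ?_, fun U l hl => (hU₀ U).trans (by rw [Option.mem_def.1 hl]; rfl)⟩
    cases h : act U₀ with
    | none => exact one_pos
    | some l => exact hact U₀ l h
  let t : Finset (Fin n) → ℝ := fun U => ((Uᶜ).card : ℝ) / q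
  have ht0 : ∀ U, 0 ≤ t U := fun U => by positivity
  have hstep : ∀ U, ∀ l ∈ act U, ∑ S, (l.prob S : ℝ) * t (S ∪ U) + 1 ≤ t U := by
    intro U l hl
    have hterm : ∀ S, (l.prob S : ℝ) * t (S ∪ U)
        ≤ (l.prob S : ℝ) * t U - (if ¬ S ⊆ U then (l.prob S : ℝ) else 0) / q := by
      intro S
      have hl0 : (0 : ℝ) ≤ l.prob S := NNReal.coe_nonneg _
      by_cases hS : S ⊆ U
      · rw [Finset.union_eq_right.2 hS]; simp [hS]
      · rw [if_pos hS]
        have hlt : ((S ∪ U)ᶜ).card + 1 ≤ (Uᶜ).card := by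
          refine Finset.card_lt_card (Finset.compl_ssubset_compl.2 ?_)
          refine Finset.ssubset_iff_subset_ne.2 ⟨Finset.subset_union_right, fun h => hS ?_⟩
          rw [h]; exact Finset.subset_union_left
        have : t (S ∪ U) + 1 / q ≤ t U := by
          simp only [t, ← add_div]
          gcongr
          exact_mod_cast hlt
        have := mul_le_mul_of_nonneg_left this hl0
        rw [mul_add, mul_one_div] at this
        linarith
    have hsum := Finset.sum_le_sum fun S (_ : S ∈ Finset.univ) => hterm S
    rw [Finset.sum_sub_distrib, ← Finset.sum_mul, ← Finset.sum_div, l.sum_coe_prob, one_mul,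
      ← Finset.sum_filter] at hsum
    have : 1 ≤ l.progress U / q := (one_le_div hq0).2 (hq U l hl)
    unfold Lottery.progress at this
    linarith
  have hmain : ∀ (k : ℕ) U, k * survival act k U ≤ t U := by
    intro k
    induction k with
    | zero => intro U; simpa using ht0 U
    | succ k ih =>
      intro U
      rw [survival]
      cases hl : act U with
      | none => simpa using ht0 U
      | some l =>
        refine le_trans ?_ (hstep U l hl)
        calc ((k + 1 : ℕ) : ℝ) * ∑ S, (l.prob S : ℝ) * survival act k (S ∪ U)
            = ∑ S, (l.prob S : ℝ) * (k * survival act k (S ∪ U) + survival act k (S ∪ U)) := by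
              rw [Finset.mul_sum]
              exact Finset.sum_congr rfl fun S _ => by push_cast; ring
          _ ≤ ∑ S, (l.prob S : ℝ) * (t (S ∪ U) + 1) :=
              Finset.sum_le_sum fun S _ => mul_le_mul_of_nonneg_left
                (add_le_add (ih _) (survival_le_one _ _ _)) (NNReal.coe_nonneg _)
          _ = _ := by simp only [mul_add, mul_one, Finset.sum_add_distrib, l.sum_coe_prob]
  exact ⟨t ∅, fun k => hmain k ∅⟩

section FiniteMenu

variable {L : Set (Lottery n)} (v : Valuation n)

/-- An entry without progress leaves `U` unchanged and cannot help. Were stopping and the finitely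
many progressing entries all strictly worse than `best`, their maximum `m` would bound every finite
horizon by induction, hence `best` itself. -/
theorem exists_progress_of_finite (hL : L.Finite) (U : Finset (Fin n)) :
    best L v U ≤ v.1 U ∨ ∃ l ∈ L, 0 < l.progress U ∧
      best L v U + l.price ≤ ∑ S, (l.prob S : ℝ≥0∞) * best L v (S ∪ U) := by
  by_contra! hcon
  obtain ⟨hv, hlt⟩ := hcon
  let g : Lottery n → ℝ≥0∞ := fun l => (∑ S, (l.prob S : ℝ≥0∞) * best L v (S ∪ U)) - l.price
  let m : ℝ≥0∞ := v.1 U ⊔ (hL.toFinset.filter fun l => 0 < l.progress U).sup g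
  have hm : m < best L v U := by
    refine sup_lt_iff.2 ⟨hv, (Finset.sup_lt_iff (bot_le.trans_lt hv)).2 fun l hl => ?_⟩
    simp only [Finset.mem_filter, Set.Finite.mem_toFinset] at hl
    rcases le_total (∑ S, (l.prob S : ℝ≥0∞) * best L v (S ∪ U)) l.price with h | h
    · simp only [g, tsub_eq_zero_of_le h]; exact bot_le.trans_lt hv
    · exact (ENNReal.sub_lt_iff_lt_right ENNReal.coe_ne_top h).2 (hlt l hl.1 hl.2)
  refine absurd (iSup_le fun k => ?_) (not_le.2 hm)
  induction k with
  | zero => exact le_sup_left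
  | succ k ih =>
    refine sup_le le_sup_left (iSup₂_le fun l hl => ?_)
    rcases (l.progress_nonneg U).eq_or_lt with h | h
    · refine tsub_le_self.trans (le_trans (le_of_eq ?_) ih)
      calc ∑ S, (l.prob S : ℝ≥0∞) * bestWithin L v k (S ∪ U)
          = ∑ S, (l.prob S : ℝ≥0∞) * bestWithin L v k U := by
            refine Finset.sum_congr rfl fun S _ => ?_
            by_cases hS : l.prob S = 0
            · simp [hS]
            · rw [Finset.union_eq_right.2 (Lottery.subset_of_progress_eq_zero h.symm hS)]
        _ = bestWithin L v k U := by rw [← Finset.sum_mul, l.sum_ennreal_prob, one_mul]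
    · refine le_trans ?_ (le_sup_of_le_right (Finset.le_sup (f := g)
        (Finset.mem_filter.2 ⟨hL.mem_toFinset.2 hl, h⟩)))
      refine tsub_le_tsub_right (Finset.sum_le_sum fun S _ => mul_le_mul_right ?_ _) _
      exact le_iSup (fun k => bestWithin L v k (S ∪ U)) k

/-- Always buying a progressing entry that attains `best` loses, within `k` purchases, at most `M`
times the probability of not having stopped, which is `O(1 / k)`. Insisting on progress excludes
strategies that postpone stopping forever. -/
theorem exists_isOptimal_of_finite (hL : L.Finite) : ∃ σ : Strategy n, IsOptimal L v σ := by
  have hex : ∀ U, ∃ o : Option (Lottery n), (o = none → best L v U ≤ v.1 U) ∧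
      ∀ l ∈ o, l ∈ L ∧ 0 < l.progress U ∧
        best L v U + l.price ≤ ∑ S, (l.prob S : ℝ≥0∞) * best L v (S ∪ U) := by
    intro U
    rcases exists_progress_of_finite v hL U with h | ⟨l, h⟩
    · exact ⟨none, fun _ => h, by simp⟩
    · exact ⟨some l, by simp, by simpa using h⟩
  choose act hnone hsome using hex
  obtain ⟨T, hT⟩ := exists_mul_survival_le fun U l hl => (hsome U l hl).2.1
  let σ : Strategy n := fun h => act (owned h)
  have hbuys : σ.BuysFrom L := fun h l hl => (hsome _ l hl).1
  let M : ℝ := v.1 Finset.univ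
  have hstep : ∀ U, ∀ l ∈ act U, (best L v U).toReal + l.price
      ≤ ∑ S, (l.prob S : ℝ) * (best L v (S ∪ U)).toReal := by
    intro U l hl
    have := ENNReal.toReal_mono (ENNReal.sum_ne_top.2 fun S _ =>
      ENNReal.mul_ne_top ENNReal.coe_ne_top (best_ne_top L v _)) (hsome U l hl).2.2
    rwa [toReal_sum_mul_best, ENNReal.toReal_add (best_ne_top L v U) ENNReal.coe_ne_top,
      ENNReal.coe_toReal] at this
  have hmain : ∀ (k : ℕ) (h : List (Finset (Fin n))),
      (best L v (owned h)).toReal + σ.paymentFrom k h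
        ≤ σ.valueFrom v k h + M * survival act k (owned h) := by
    intro k
    induction k with
    | zero =>
      intro h
      have := ENNReal.toReal_mono ENNReal.coe_ne_top
        (iSup_le fun k => bestWithin_le L v k (owned h))
      simp only [Strategy.paymentFrom, Strategy.valueFrom, survival, NNReal.coe_zero, add_zero,
        mul_one]
      exact le_add_of_nonneg_of_le (NNReal.coe_nonneg _) this
    | succ k ih =>
      intro h
      rw [survival]
      cases hl : act (owned h) with
      | none =>
        have hl' : σ h = none := hl
        rw [Strategy.valueFrom_none hl', Strategy.paymentFrom_none hl']
        have := ENNReal.toReal_mono ENNReal.coe_ne_top (hnone _ hl)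
        simpa using this
      | some l =>
        have hl' : σ h = some l := hl
        rw [Strategy.valueFrom_some hl', Strategy.paymentFrom_some hl']
        push_cast
        have hsum : ∑ S, (l.prob S : ℝ)
              * ((best L v (S ∪ owned h)).toReal + σ.paymentFrom k (S :: h))
            ≤ ∑ S, (l.prob S : ℝ)
              * (σ.valueFrom v k (S :: h) + M * survival act k (S ∪ owned h)) :=
          Finset.sum_le_sum fun S _ =>
            mul_le_mul_of_nonneg_left (ih (S :: h)) (NNReal.coe_nonneg _)
        simp only [mul_add, Finset.sum_add_distrib] at hsum
        have hM : M * ∑ S, (l.prob S : ℝ) * survival act k (S ∪ owned h)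
            = ∑ S, (l.prob S : ℝ) * (M * survival act k (S ∪ owned h)) := by
          rw [Finset.mul_sum]
          exact Finset.sum_congr rfl fun S _ => by ring
        simp only [Option.elim_some]
        linarith [hstep _ l hl]
  have hM0 : 0 ≤ M := NNReal.coe_nonneg _
  have hlim : ∀ m : ℕ, (best L v ∅).toReal + σ.paymentFrom m [] ≤ (σ.value v).toReal := by
    intro m
    have htend : Filter.Tendsto (fun k : ℕ => (σ.value v).toReal + M * (T / k)) Filter.atTop
        (nhds ((σ.value v).toReal + M * 0)) :=
      ((tendsto_const_div_atTop_nhds_zero_nat T).const_mul M).const_add _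
    rw [mul_zero, add_zero] at htend
    refine ge_of_tendsto htend ?_
    filter_upwards [Filter.eventually_ge_atTop m, Filter.eventually_gt_atTop 0] with k hk hk0
    have h1 := hmain k []
    have h2 : (σ.paymentFrom m [] : ℝ) ≤ σ.paymentFrom k [] := σ.paymentFrom_mono [] hk
    have h3 := σ.valueFrom_le_toReal_value v k
    have h4 : M * survival act k ∅ ≤ M * (T / k) := by
      refine mul_le_mul_of_nonneg_left ?_ hM0
      rw [le_div_iff₀ (by exact_mod_cast hk0), mul_comm]
      exact hT k
    rw [owned_nil] at h1
    linarith
  have hpay : σ.payment ≤ ENNReal.ofReal ((σ.value v).toReal - (best L v ∅).toReal) :=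
    Strategy.payment_le_ofReal fun k => by linarith [hlim k]
  have hp : σ.payment ≠ ⊤ := ne_top_of_le_ne_top ENNReal.ofReal_ne_top hpay
  refine ⟨σ, isOptimal_of_best_le hbuys hp ?_⟩
  have h0 : 0 ≤ (σ.value v).toReal - (best L v ∅).toReal := by
    have := hlim 0
    have h0 : (0 : ℝ) ≤ σ.paymentFrom 0 [] := NNReal.coe_nonneg _
    linarith
  have := ENNReal.toReal_mono ENNReal.ofReal_ne_top hpay
  rw [ENNReal.toReal_ofReal h0] at this
  linarith

end FiniteMenu

/-! ### Discretization of a menu -/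

theorem isExcessive_iff {L : Set (Lottery n)} {c : ℝ} {f : Finset (Fin n) → ℝ} :
    IsExcessive L c f ↔
      ∀ l ∈ L, ∀ U, ∑ S, (l.prob S : ℝ) * (f (S ∪ U) - f U) ≤ c * l.price := by
  refine forall₃_congr fun l _ U => ?_
  simp only [mul_sub, Finset.sum_sub_distrib]
  rw [← Finset.sum_mul, l.sum_coe_prob, one_mul, sub_le_iff_le_add']

/-- The lottery with its price multiplied by `a`. -/
def Lottery.scale (a : ℝ≥0) (l : Lottery n) : Lottery n := ⟨l.prob, l.sum_prob, a * l.price⟩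

theorem isExcessive_scale {L : Set (Lottery n)} {a : ℝ≥0} {c : ℝ} {f : Finset (Fin n) → ℝ} :
    IsExcessive (Lottery.scale a '' L) c f ↔ IsExcessive L (c * a) f := by
  simp [IsExcessive, Lottery.scale, mul_assoc]

/-- The lottery which allocates `S` with probability `w S`, and nothing otherwise. -/
def Lottery.ofWeights (w : Finset (Fin n) → ℝ≥0) (hw : ∑ S, w S ≤ 1) (t : ℝ≥0) : Lottery n where
  prob S := w S + if S = ∅ then 1 - ∑ T, w T else 0
  sum_prob := by
    rw [Finset.sum_add_distrib, Finset.sum_ite_eq' Finset.univ, if_pos (Finset.mem_univ _),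
      add_tsub_cancel_of_le hw]
  price := t

theorem Lottery.sum_ofWeights_mul (w : Finset (Fin n) → ℝ≥0) (hw : ∑ S, w S ≤ 1) (t : ℝ≥0)
    (f : Finset (Fin n) → ℝ) (U : Finset (Fin n)) :
    ∑ S, ((ofWeights w hw t).prob S : ℝ) * (f (S ∪ U) - f U)
      = ∑ S, (w S : ℝ) * (f (S ∪ U) - f U) := by
  refine Finset.sum_congr rfl fun S _ => ?_
  by_cases hS : S = ∅
  · simp [hS]
  · simp [ofWeights, hS]

/-- The increments `f (S ∪ U) - f U` of monotone functions that are excessive for `L`. -/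
def increments (L : Set (Lottery n)) (S : Finset (Fin n)) : Set ℝ :=
  {d | ∃ f, Monotone f ∧ IsExcessive L 1 f ∧ ∃ U, d = f (S ∪ U) - f U}

/-- The price at which the set `S` can be obtained with certainty, in the limit, from the menu
`L`, given by the dual description. -/
noncomputable def cost (L : Set (Lottery n)) (S : Finset (Fin n)) : ℝ := sSup (increments L S)

section Cost

variable {L : Set (Lottery n)}

theorem increments_nonneg {S : Finset (Fin n)} {d : ℝ} (hd : d ∈ increments L S) : 0 ≤ d := by
  obtain ⟨f, hf, -, U, rfl⟩ := hd
  exact sub_nonneg.2 (hf Finset.subset_union_right)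

theorem cost_nonneg (S : Finset (Fin n)) : 0 ≤ cost L S :=
  Real.sSup_nonneg fun _ => increments_nonneg

theorem prob_mul_le_price {l : Lottery n} (hl : l ∈ L) {S : Finset (Fin n)} {d : ℝ}
    (hd : d ∈ increments L S) : l.prob S * d ≤ l.price := by
  obtain ⟨f, hf, hfL, U, rfl⟩ := hd
  have h := isExcessive_iff.1 hfL l hl U
  rw [one_mul] at h
  refine le_trans ?_ h
  exact Finset.single_le_sum (f := fun S => (l.prob S : ℝ) * (f (S ∪ U) - f U))
    (fun T _ => mul_nonneg (NNReal.coe_nonneg _) (sub_nonneg.2 (hf Finset.subset_union_right)))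
    (Finset.mem_univ S)

theorem bddAbove_increments {l : Lottery n} (hl : l ∈ L) {S : Finset (Fin n)}
    (hS : 0 < l.prob S) : BddAbove (increments L S) := by
  refine ⟨l.price / l.prob S, fun d hd => ?_⟩
  rw [le_div_iff₀ (by exact_mod_cast hS), mul_comm]
  exact prob_mul_le_price hl hd

theorem prob_mul_cost_le {l : Lottery n} (hl : l ∈ L) (S : Finset (Fin n)) :
    l.prob S * cost L S ≤ l.price := by
  rcases eq_or_ne (l.prob S) 0 with h | h
  · simp [h]
  have hpos : (0 : ℝ) < l.prob S := by exact_mod_cast pos_iff_ne_zero.2 h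
  rw [mul_comm, ← le_div_iff₀ hpos]
  refine Real.sSup_le (fun d hd => ?_) (by positivity)
  rw [le_div_iff₀ hpos, mul_comm]
  exact prob_mul_le_price hl hd

/-- The price common to all the entries of the discretized menu. -/
noncomputable def unitPrice (L : Set (Lottery n)) : ℝ := (1 + ∑ S, (cost L S)⁻¹)⁻¹

theorem sum_inv_cost_nonneg : 0 ≤ ∑ S, (cost L S)⁻¹ :=
  Finset.sum_nonneg fun S _ => inv_nonneg.2 (cost_nonneg S)

theorem unitPrice_pos : 0 < unitPrice L :=
  inv_pos.2 (by linarith [sum_inv_cost_nonneg (L := L)])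

/-- The probabilities of the entry of the discretized menu given by `k`. -/
noncomputable def gridWeight (L : Set (Lottery n)) (K : ℕ) (k : Finset (Fin n) → Fin (K + 1))
    (S : Finset (Fin n)) : ℝ :=
  (k S : ℝ) / K * (cost L S)⁻¹ * unitPrice L

theorem gridWeight_nonneg (K : ℕ) (k : Finset (Fin n) → Fin (K + 1)) (S : Finset (Fin n)) :
    0 ≤ gridWeight L K k S :=
  mul_nonneg (mul_nonneg (by positivity) (inv_nonneg.2 (cost_nonneg S))) unitPrice_pos.le

/-- `unitPrice` is small enough for even the largest grid point to fit; its summand 1 keeps it well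
defined when all inverse costs vanish. -/
theorem sum_gridWeight_le (K : ℕ) (k : Finset (Fin n) → Fin (K + 1)) :
    ∑ S, (gridWeight L K k S).toNNReal ≤ 1 := by
  rw [← NNReal.coe_le_coe]
  push_cast
  calc ∑ S, ((gridWeight L K k S).toNNReal : ℝ)
      ≤ ∑ S, (cost L S)⁻¹ * unitPrice L := by
        refine Finset.sum_le_sum fun S _ => ?_
        rw [Real.coe_toNNReal _ (gridWeight_nonneg K k S), gridWeight]
        refine mul_le_mul_of_nonneg_right ?_ unitPrice_pos.le
        refine mul_le_of_le_one_left (inv_nonneg.2 (cost_nonneg S)) ?_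
        exact div_le_one_of_le₀ (by exact_mod_cast Nat.lt_succ_iff.1 (k S).2) (by positivity)
    _ = (∑ S, (cost L S)⁻¹) / (1 + ∑ S, (cost L S)⁻¹) := by
        rw [← Finset.sum_mul, unitPrice, div_eq_mul_inv]
    _ ≤ 1 := div_le_one_of_le₀ (by linarith) (by linarith [sum_inv_cost_nonneg (L := L)])

/-- The entry of the discretized menu given by `k`. -/
noncomputable def gridLottery (L : Set (Lottery n)) (K : ℕ)
    (k : Finset (Fin n) → Fin (K + 1)) : Lottery n :=
  .ofWeights (fun S => (gridWeight L K k S).toNNReal) (sum_gridWeight_le K k)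
    (unitPrice L).toNNReal

/-- The entry allocating the set `S` for free. -/
noncomputable def freeLottery (S : Finset (Fin n)) : Lottery n :=
  .ofWeights (fun T => if T = S then 1 else 0) (by simp) 0

/-- The mass added on `∅` causes no increment and the unit price cancels, so only the grid vector
matters. -/
theorem isExcessive_singleton_gridLottery {K : ℕ} {k : Finset (Fin n) → Fin (K + 1)} {c : ℝ}
    {f : Finset (Fin n) → ℝ} :
    IsExcessive {gridLottery L K k} c f ↔
      ∀ U, ∑ S, (k S : ℝ) / K * (cost L S)⁻¹ * (f (S ∪ U) - f U) ≤ c := by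
  rw [isExcessive_iff]
  simp only [Set.mem_singleton_iff, forall_eq]
  refine forall_congr' fun U => ?_
  rw [gridLottery, Lottery.sum_ofWeights_mul]
  have hsum : ∑ S, ((gridWeight L K k S).toNNReal : ℝ) * (f (S ∪ U) - f U)
      = (∑ S, (k S : ℝ) / K * (cost L S)⁻¹ * (f (S ∪ U) - f U)) * unitPrice L := by
    rw [Finset.sum_mul]
    refine Finset.sum_congr rfl fun S _ => ?_
    rw [Real.coe_toNNReal _ (gridWeight_nonneg _ _ _), gridWeight]
    ring
  simp only [hsum, Lottery.ofWeights, Real.coe_toNNReal _ (unitPrice_pos (L := L)).le]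
  exact mul_le_mul_iff_left₀ unitPrice_pos

theorem isExcessive_singleton_freeLottery {S : Finset (Fin n)} {c : ℝ}
    {f : Finset (Fin n) → ℝ} :
    IsExcessive {freeLottery S} c f ↔ ∀ U, f (S ∪ U) - f U ≤ 0 := by
  rw [isExcessive_iff]
  simp only [Set.mem_singleton_iff, forall_eq]
  refine forall_congr' fun U => ?_
  rw [freeLottery, Lottery.sum_ofWeights_mul, Finset.sum_eq_single S]
  · simp [Lottery.ofWeights]
  · intro T _ hT; simp [hT]
  · simp

theorem IsExcessive.mono {L' : Set (Lottery n)} {c : ℝ} {f : Finset (Fin n) → ℝ}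
    (hf : IsExcessive L c f) (h : L' ⊆ L) : IsExcessive L' c f :=
  fun l hl => hf l (h hl)

open Classical in
/-- The discretized menu: those free entries and those entries on the grid that do not improve
upon the menu `L`. -/
noncomputable def gridMenu (L : Set (Lottery n)) (K : ℕ) : Finset (Lottery n) :=
  (Finset.univ.image (gridLottery L K) ∪ Finset.univ.image freeLottery).filter fun l =>
    ∀ f, Monotone f → IsExcessive L 1 f → IsExcessive {l} 1 f

theorem card_gridMenu_le (K : ℕ) : (gridMenu L K).card ≤ (K + 1) ^ 2 ^ n + 2 ^ n := by
  classical
  refine (Finset.card_filter_le _ _).trans ((Finset.card_union_le _ _).trans ?_)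
  refine add_le_add (Finset.card_image_le.trans ?_) (Finset.card_image_le.trans ?_)
  · simp
  · simp

theorem isExcessive_gridMenu {f : Finset (Fin n) → ℝ} (hf : Monotone f)
    (hfL : IsExcessive L 1 f) (K : ℕ) : IsExcessive (gridMenu L K : Set (Lottery n)) 1 f := by
  classical
  exact fun l hl => (Finset.mem_filter.1 (Finset.mem_coe.1 hl)).2 f hf hfL l rfl

theorem IsExcessive.gridLottery {K : ℕ} {c : ℝ} {f : Finset (Fin n) → ℝ}
    (hf : IsExcessive (gridMenu L K : Set (Lottery n)) c f) (k : Finset (Fin n) → Fin (K + 1))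
    (hk : ∀ g, Monotone g → IsExcessive L 1 g →
      ∀ U, ∑ S, (k S : ℝ) / K * (cost L S)⁻¹ * (g (S ∪ U) - g U) ≤ 1) (U : Finset (Fin n)) :
    ∑ S, (k S : ℝ) / K * (cost L S)⁻¹ * (f (S ∪ U) - f U) ≤ c := by
  classical
  refine isExcessive_singleton_gridLottery.1 (hf.mono (Set.singleton_subset_iff.2 ?_)) U
  refine Finset.mem_coe.2 (Finset.mem_filter.2 ⟨Finset.mem_union_left _ ?_, fun g hg hgL => ?_⟩)
  · exact Finset.mem_image_of_mem _ (Finset.mem_univ k)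
  · exact isExcessive_singleton_gridLottery.2 (hk g hg hgL)

theorem IsExcessive.freeLottery {K : ℕ} {c : ℝ} {f : Finset (Fin n) → ℝ}
    (hf : IsExcessive (gridMenu L K : Set (Lottery n)) c f) {S : Finset (Fin n)}
    (hS : ∀ d ∈ increments L S, d ≤ 0) (U : Finset (Fin n)) : f (S ∪ U) - f U ≤ 0 := by
  classical
  refine isExcessive_singleton_freeLottery.1 (hf.mono (Set.singleton_subset_iff.2 ?_)) U
  refine Finset.mem_coe.2 (Finset.mem_filter.2 ⟨Finset.mem_union_right _ ?_, fun g hg hgL => ?_⟩)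
  · exact Finset.mem_image_of_mem _ (Finset.mem_univ S)
  · exact isExcessive_singleton_freeLottery.2 fun U => hS _ ⟨g, hg, hgL, U, rfl⟩

/-- The grid point with full weight on `S` alone belongs to the menu. Boundedness is essential:
otherwise `sSup` takes the default value 0 and `cost` is meaningless. -/
theorem IsExcessive.inv_cost_mul_le {K : ℕ} (hK : 0 < K) {c : ℝ}
    {f : Finset (Fin n) → ℝ} (hf : IsExcessive (gridMenu L K : Set (Lottery n)) c f)
    {S : Finset (Fin n)} (hS : BddAbove (increments L S)) (U : Finset (Fin n)) :
    (cost L S)⁻¹ * (f (S ∪ U) - f U) ≤ c := by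
  have hK' : (K : ℝ) ≠ 0 := by exact_mod_cast hK.ne'
  have hsum : ∀ (g : Finset (Fin n) → ℝ) V,
      ∑ T, (((if T = S then Fin.last K else 0 : Fin (K + 1)) : ℕ) : ℝ) / K * (cost L T)⁻¹
        * (g (T ∪ V) - g V) = (cost L S)⁻¹ * (g (S ∪ V) - g V) := by
    intro g V
    rw [Finset.sum_eq_single S]
    · simp [hK']
    · intro T _ hT; simp [hT]
    · simp
  rw [← hsum]
  refine hf.gridLottery _ (fun g hg hgL V => ?_) U
  rw [hsum]
  have hle : g (S ∪ V) - g V ≤ cost L S := le_csSup hS ⟨g, hg, hgL, V, rfl⟩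
  rw [mul_comm, ← div_eq_mul_inv]
  exact div_le_one_of_le₀ hle (cost_nonneg S)

/-- The rounded-down entry contributes at most `c`, and each of the `2 ^ n` remainders, being at
most `1 / K`, contributes at most `c / K` by `IsExcessive.inv_cost_mul_le`. -/
theorem IsExcessive.of_gridMenu {K : ℕ} (hK : 0 < K) {c : ℝ} (hc : 0 ≤ c)
    {f : Finset (Fin n) → ℝ} (hf : IsExcessive (gridMenu L K : Set (Lottery n)) c f) :
    IsExcessive L (c * (1 + 2 ^ n / K)) f := by
  have hK' : (0 : ℝ) < K := by exact_mod_cast hK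
  rw [isExcessive_iff]
  intro l hl U
  have hprob : ∀ S, (0 : ℝ) ≤ l.prob S := fun S => NNReal.coe_nonneg _
  rcases eq_or_ne l.price 0 with hp | hp
  -- Sets that a free entry of `L` allocates have no positive increments, so the menu gives them
  -- away.
  · rw [hp, NNReal.coe_zero, mul_zero]
    refine Finset.sum_nonpos fun S _ => ?_
    rcases (hprob S).eq_or_lt with h | h
    · simp [← h]
    refine mul_nonpos_of_nonneg_of_nonpos h.le (hf.freeLottery (fun d hd => ?_) U)
    have := prob_mul_le_price hl hd
    rw [hp, NNReal.coe_zero] at this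
    exact nonpos_of_mul_nonpos_right this h
  have hp' : (0 : ℝ) < l.price := by exact_mod_cast pos_iff_ne_zero.2 hp
  let y : Finset (Fin n) → ℝ := fun S => l.prob S * cost L S / l.price
  have hy0 : ∀ S, 0 ≤ y S := fun S => div_nonneg (mul_nonneg (hprob S) (cost_nonneg S)) hp'.le
  have hy1 : ∀ S, y S ≤ 1 := fun S => div_le_one_of_le₀ (prob_mul_cost_le hl S) hp'.le
  have hfloor : ∀ S, ⌊K * y S⌋₊ < K + 1 := fun S => by
    rw [Nat.lt_succ_iff]
    refine Nat.floor_le_of_le ?_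
    exact mul_le_of_le_one_right hK'.le (hy1 S)
  let k : Finset (Fin n) → Fin (K + 1) := fun S => ⟨⌊K * y S⌋₊, hfloor S⟩
  have hk_le : ∀ S, (k S : ℝ) / K ≤ y S := fun S => by
    rw [div_le_iff₀ hK', mul_comm]
    exact Nat.floor_le (mul_nonneg hK'.le (hy0 S))
  have hk_ge : ∀ S, y S - (k S : ℝ) / K ≤ 1 / K := fun S => by
    rw [sub_le_iff_le_add, ← add_div, le_div_iff₀ hK', mul_comm, add_comm]
    exact (Nat.lt_floor_add_one _).le
  have hgrid := hf.gridLottery k (fun g hg hgL V => ?_) U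
  · have hterm : ∀ S, l.prob S * (f (S ∪ U) - f U)
        ≤ l.price * ((k S : ℝ) / K * (cost L S)⁻¹ * (f (S ∪ U) - f U)) + l.price * c / K := by
      intro S
      have hrem : 0 ≤ l.price * c / K := by positivity
      rcases (hprob S).eq_or_lt with h | h
      · have : (k S : ℝ) = 0 := by simp [k, y, ← h]
        rw [← h, this]
        simpa using hrem
      have hbdd := bddAbove_increments hl (by exact_mod_cast h)
      rcases (cost_nonneg (L := L) S).eq_or_lt with h0 | h0
      · rw [← h0, inv_zero, mul_zero, zero_mul, mul_zero, zero_add]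
        refine le_trans (mul_nonpos_of_nonneg_of_nonpos h.le ?_) hrem
        exact hf.freeLottery (fun d hd => (le_csSup hbdd hd).trans h0.ge) U
      · have hD := hf.inv_cost_mul_le hK hbdd U
        have hx : (l.prob S : ℝ) * (f (S ∪ U) - f U)
            = l.price * (y S * ((cost L S)⁻¹ * (f (S ∪ U) - f U))) := by
          simp only [y]
          field_simp
        have h1 : (y S - (k S : ℝ) / K) * ((cost L S)⁻¹ * (f (S ∪ U) - f U)) ≤ 1 / K * c :=
          (mul_le_mul_of_nonneg_left hD (sub_nonneg.2 (hk_le S))).trans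
            (mul_le_mul_of_nonneg_right (hk_ge S) hc)
        have h2 := mul_le_mul_of_nonneg_left h1 hp'.le
        rw [hx]
        calc _ = l.price * ((k S : ℝ) / K * (cost L S)⁻¹ * (f (S ∪ U) - f U))
              + l.price * ((y S - (k S : ℝ) / K) * ((cost L S)⁻¹ * (f (S ∪ U) - f U))) := by ring
          _ ≤ _ := by
            refine add_le_add le_rfl (h2.trans (le_of_eq ?_))
            ring
    calc ∑ S, (l.prob S : ℝ) * (f (S ∪ U) - f U)
        ≤ ∑ S, (l.price * ((k S : ℝ) / K * (cost L S)⁻¹ * (f (S ∪ U) - f U))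
            + l.price * c / K) := Finset.sum_le_sum fun S _ => hterm S
      _ = l.price * (∑ S, (k S : ℝ) / K * (cost L S)⁻¹ * (f (S ∪ U) - f U))
            + 2 ^ n * (l.price * c / K) := by
          rw [Finset.sum_add_distrib, ← Finset.mul_sum]
          simp
      _ ≤ l.price * c + 2 ^ n * (l.price * c / K) :=
          add_le_add (mul_le_mul_of_nonneg_left hgrid hp'.le) le_rfl
      _ = _ := by ring
  -- The rounded entry passes the filter of `gridMenu`: rounding down makes its ratios at most those
  -- of `l`, and increments of monotone functions are nonnegative.
  · have h := isExcessive_iff.1 hgL l hl V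
    rw [one_mul] at h
    have hg0 : ∀ S, 0 ≤ g (S ∪ V) - g V := fun S => sub_nonneg.2 (hg Finset.subset_union_right)
    calc ∑ S, (k S : ℝ) / K * (cost L S)⁻¹ * (g (S ∪ V) - g V)
        ≤ ∑ S, l.prob S / l.price * (g (S ∪ V) - g V) := by
          refine Finset.sum_le_sum fun S _ => mul_le_mul_of_nonneg_right ?_ (hg0 S)
          rcases (cost_nonneg (L := L) S).eq_or_lt with h0 | h0
          · rw [← h0, inv_zero, mul_zero]; positivity
          · rw [← div_eq_mul_inv, div_le_iff₀ h0]
            refine (hk_le S).trans (le_of_eq ?_)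
            simp only [y]; ring
      _ = (∑ S, l.prob S * (g (S ∪ V) - g V)) / l.price := by
          rw [Finset.sum_div]
          exact Finset.sum_congr rfl fun S _ => by ring
      _ ≤ 1 := div_le_one_of_le₀ h hp'.le

end Cost

/-! ### Comparison of revenues -/

open Classical in
theorem exists_finset_revAt_ge (L : Set (Lottery n)) {K : ℕ} (hK : 0 < K) {b : ℝ} (hb0 : 0 < b)
    (hb1 : b < 1) :
    ∃ L' : Finset (Lottery n), L'.card ≤ (K + 1) ^ 2 ^ n + 2 ^ n ∧
      ∀ v, ENNReal.ofReal ((1 - b) * (1 - 2 ^ n / K / b)) * revAt L v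
        ≤ revAt (L' : Set (Lottery n)) v := by
  have ha : (((1 - b).toNNReal : ℝ≥0) : ℝ) = 1 - b := Real.coe_toNNReal _ (by linarith)
  refine ⟨(gridMenu L K).image (Lottery.scale (1 - b).toNNReal),
    Finset.card_image_le.trans (card_gridMenu_le K), fun v => ?_⟩
  set L' := (gridMenu L K).image (Lottery.scale (1 - b).toNNReal) with hL'
  have hL'c : (L' : Set (Lottery n)) = Lottery.scale (1 - b).toNNReal '' gridMenu L K := by
    rw [hL', Finset.coe_image]
  obtain ⟨σ', hσ'⟩ := exists_isOptimal_of_finite v L'.finite_toSet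
  have hge : σ'.payment ≤ revAt (L' : Set (Lottery n)) v :=
    le_iSup₂ (f := fun (σ : Strategy n) (_ : IsOptimal (L' : Set (Lottery n)) v σ) => σ.payment)
      σ' hσ'
  refine le_trans ?_ hge
  simp only [revAt, ENNReal.mul_iSup]
  refine iSup₂_le fun σ hσ => ?_
  have h1 := hσ.best_le
  have h2 := hσ'.best_le
  -- The lower prices of `L'` worsen the factor to `1 / (1 - b)` here, but improve the factor in
  -- `h4` to `(1 - b) * (1 + d)`, below 1 once `d ≤ b`.
  have h3 : IsExcessive (L' : Set (Lottery n)) (1 / (1 - b)) fun U => (best L v U).toReal := by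
    rw [hL'c, isExcessive_scale, ha, one_div_mul_cancel (by linarith)]
    exact isExcessive_gridMenu (toReal_best_mono L v) (isExcessive_best L v) K
  have h3 := h3.value_le (by rw [one_div]; exact inv_nonneg.2 (by linarith))
    (coe_le_toReal_best L v) hσ'.1 hσ'.payment_ne_top
  have h4 := isExcessive_best (L' : Set (Lottery n)) v
  rw [hL'c, isExcessive_scale, ha, one_mul, ← hL'c] at h4
  have h4 := (h4.of_gridMenu hK (by linarith)).value_le
    (mul_nonneg (by linarith) (by positivity)) (coe_le_toReal_best _ v) hσ.1 hσ.payment_ne_top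
  have hP := ENNReal.toReal_nonneg (a := σ.payment)
  rw [← ENNReal.ofReal_toReal hσ.payment_ne_top, ← ENNReal.ofReal_toReal hσ'.payment_ne_top,
    ← ENNReal.ofReal_mul' hP]
  refine ENNReal.ofReal_le_ofReal ?_
  generalize σ.payment.toReal = P at *
  generalize σ'.payment.toReal = P' at *
  have hd : (0 : ℝ) ≤ 2 ^ n / K := by positivity
  generalize (2 ^ n / K : ℝ) = d at *
  have h5 : (1 - (1 - b) * (1 + d)) * P ≤ (b / (1 - b)) * P' := by
    have : (1 / (1 - b)) * P' - P' = (b / (1 - b)) * P' := by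
      field_simp [(by linarith : (1 - b) ≠ 0)]
      ring
    linarith
  have h6 : (b - d) * P ≤ (1 - (1 - b) * (1 + d)) * P :=
    mul_le_mul_of_nonneg_right (by nlinarith) hP
  have h7 : (b - d) * P ≤ b * P' / (1 - b) := by
    rw [mul_div_right_comm]; linarith
  rw [le_div_iff₀ (by linarith)] at h7
  calc (1 - b) * (1 - d / b) * P = (b - d) * P * (1 - b) / b := by
        field_simp
    _ ≤ P' := by rw [div_le_iff₀ hb0, mul_comm P']; exact h7

theorem exists_finset_rev_ge (D : Measure (Valuation n)) (L : Set (Lottery n)) {ε : ℝ}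
    (h0 : 0 < ε) (h1 : ε < 1) :
    ∃ L' : Finset (Lottery n),
      (L'.card : ℝ) ≤ 2 * ((16 * 2 ^ n) ^ (6 * 2 ^ n) * (ε⁻¹) ^ (12 * 2 ^ n)) ∧
      ENNReal.ofReal ((1 - ε / 3) ^ 2) * rev D L ≤ rev D (L' : Set (Lottery n)) := by
  have hN : (1 : ℝ) ≤ 2 ^ n := one_le_pow₀ (by norm_num)
  have hε : 1 ≤ ε⁻¹ := (one_le_inv₀ h0).2 h1.le
  -- With `b = ε / 3`, this makes `2 ^ n / K / b ≤ ε / 3`, so both factors lost are at least `1 - ε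
  -- / 3`.
  let K : ℕ := ⌈9 * 2 ^ n * (ε⁻¹) ^ 2⌉₊
  have hKge : 9 * 2 ^ n * (ε⁻¹) ^ 2 ≤ (K : ℝ) := Nat.le_ceil _
  have hKle : (K : ℝ) ≤ 9 * 2 ^ n * (ε⁻¹) ^ 2 + 1 := (Nat.ceil_lt_add_one (by positivity)).le
  have hK : 0 < K := Nat.ceil_pos.2 (by positivity)
  have hK' : (0 : ℝ) < K := by exact_mod_cast hK
  obtain ⟨L', hcard, hL'⟩ := exists_finset_revAt_ge L hK (b := ε / 3) (by linarith) (by linarith)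
  refine ⟨L', ?_, ?_⟩
  · have hbase : (K : ℝ) + 1 ≤ (16 * 2 ^ n) ^ 6 * (ε⁻¹) ^ 12 := by
      have e2 : 1 ≤ (ε⁻¹) ^ 2 := one_le_pow₀ hε
      have e3 : (1 : ℝ) ≤ 2 ^ n * (ε⁻¹) ^ 2 := one_le_mul_of_one_le_of_one_le hN e2
      calc (K : ℝ) + 1 ≤ 16 * 2 ^ n * (ε⁻¹) ^ 2 := by nlinarith
        _ ≤ (16 * 2 ^ n) ^ 6 * (ε⁻¹) ^ 12 := by
          refine mul_le_mul ?_ (pow_le_pow_right₀ hε (by norm_num)) (by positivity) (by positivity)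
          exact le_self_pow₀ (by linarith) (by norm_num)
    have hpow : ((K : ℝ) + 1) ^ 2 ^ n ≤ (16 * 2 ^ n) ^ (6 * 2 ^ n) * (ε⁻¹) ^ (12 * 2 ^ n) := by
      rw [pow_mul, pow_mul, ← mul_pow]
      exact pow_le_pow_left₀ (by positivity) hbase _
    have htwo : (2 : ℝ) ^ n ≤ (16 * 2 ^ n) ^ (6 * 2 ^ n) * (ε⁻¹) ^ (12 * 2 ^ n) := by
      calc (2 : ℝ) ^ n ≤ (16 * 2 ^ n) ^ (6 * 2 ^ n) :=
            le_trans (by linarith) (le_self_pow₀ (by linarith) (by positivity))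
        _ ≤ _ := le_mul_of_one_le_right (by positivity) (one_le_pow₀ hε)
    have : (L'.card : ℝ) ≤ ((K : ℝ) + 1) ^ 2 ^ n + 2 ^ n := by exact_mod_cast hcard
    linarith
  · have hle : (1 - ε / 3) ^ 2 ≤ (1 - ε / 3) * (1 - 2 ^ n / K / (ε / 3)) := by
      rw [sq]
      refine mul_le_mul_of_nonneg_left ?_ (by linarith)
      refine sub_le_sub_left ?_ 1
      rw [div_le_iff₀ (by linarith), div_le_iff₀ hK']
      calc (2 : ℝ) ^ n = ε / 3 * (ε / 3) * (9 * 2 ^ n * (ε⁻¹) ^ 2) := by field_simp; norm_num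
        _ ≤ _ := mul_le_mul_of_nonneg_left hKge (by positivity)
    -- For lower integrals this direction needs no measurability.
    calc ENNReal.ofReal ((1 - ε / 3) ^ 2) * ∫⁻ v, revAt L v ∂D
        ≤ ∫⁻ v, ENNReal.ofReal ((1 - ε / 3) ^ 2) * revAt L v ∂D := lintegral_const_mul_le _ _
      _ ≤ _ := lintegral_mono fun v =>
        (mul_le_mul_left (ENNReal.ofReal_le_ofReal hle) _).trans (hL' v)

end BuyMany

theorem mainTheorem3 :
    ∃ C : ℝ, 0 < C ∧
      ∀ (n : ℕ) (ε : ℝ), 0 < ε → ε < 1 →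
        ∀ D : Measure (BuyMany.Valuation n), IsProbabilityMeasure D →
          (BuyMany.buyManyRev D ≠ ⊤ →
            ∃ L : Finset (BuyMany.Lottery n),
              (L.card : ℝ) ≤ C * ((16 * 2 ^ n) ^ (6 * 2 ^ n) * (ε⁻¹) ^ (12 * 2 ^ n)) ∧
              ENNReal.ofReal (1 - ε) * BuyMany.buyManyRev D
                ≤ BuyMany.rev D (L : Set (BuyMany.Lottery n))) ∧
          (BuyMany.buyManyRev D = ⊤ →
            ∀ r : ℝ≥0,
              ∃ L : Finset (BuyMany.Lottery n),
                (L.card : ℝ) ≤ C * ((16 * 2 ^ n) ^ (6 * 2 ^ n) * (ε⁻¹) ^ (12 * 2 ^ n)) ∧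
                (r : ℝ≥0∞) ≤ BuyMany.rev D (L : Set (BuyMany.Lottery n))) := by
  refine ⟨2, two_pos, fun n ε h0 h1 D _ => ⟨fun hfin => ?_, fun htop r => ?_⟩⟩
  -- The supremum over menus need not be attained, which costs a third factor `1 - ε / 3`; finally
  -- `(1 - ε / 3) ^ 3 ≥ 1 - ε`.
  · obtain ⟨L, hL⟩ : ∃ L : Set (BuyMany.Lottery n),
        ENNReal.ofReal (1 - ε / 3) * BuyMany.buyManyRev D ≤ BuyMany.rev D L := by
      rcases eq_or_ne (BuyMany.buyManyRev D) 0 with hz | hz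
      · exact ⟨∅, by simp [hz]⟩
      have hlt : ENNReal.ofReal (1 - ε / 3) * BuyMany.buyManyRev D < BuyMany.buyManyRev D := by
        conv_rhs => rw [← one_mul (BuyMany.buyManyRev D)]
        refine (ENNReal.mul_lt_mul_iff_left hz hfin).2 ?_
        rw [ENNReal.ofReal_lt_one]
        linarith
      obtain ⟨L, hL⟩ := lt_iSup_iff.1 (hlt.trans_eq rfl)
      exact ⟨L, hL.le⟩
    obtain ⟨L', hcard, hrev⟩ := BuyMany.exists_finset_rev_ge D L h0 h1
    refine ⟨L', hcard, le_trans ?_ hrev⟩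
    calc ENNReal.ofReal (1 - ε) * BuyMany.buyManyRev D
        ≤ ENNReal.ofReal ((1 - ε / 3) ^ 2 * (1 - ε / 3)) * BuyMany.buyManyRev D := by
          refine mul_le_mul_left (ENNReal.ofReal_le_ofReal ?_) _
          nlinarith [mul_pos h0 h0]
      _ = ENNReal.ofReal ((1 - ε / 3) ^ 2)
            * (ENNReal.ofReal (1 - ε / 3) * BuyMany.buyManyRev D) := by
          rw [ENNReal.ofReal_mul (sq_nonneg _), mul_assoc]
      _ ≤ _ := mul_le_mul_right hL _
  · have hc : 0 < (1 - ε / 3) ^ 2 := pow_pos (by linarith) 2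
    have hlt : (r : ℝ≥0∞) / ENNReal.ofReal ((1 - ε / 3) ^ 2) < BuyMany.buyManyRev D := by
      rw [htop]
      exact ENNReal.div_lt_top ENNReal.coe_ne_top (ENNReal.ofReal_pos.2 hc |>.ne')
    obtain ⟨L, hL⟩ := lt_iSup_iff.1 (hlt.trans_eq rfl)
    obtain ⟨L', hcard, hrev⟩ := BuyMany.exists_finset_rev_ge D L h0 h1
    refine ⟨L', hcard, le_trans ?_ hrev⟩
    have := (ENNReal.div_lt_iff (Or.inl (ENNReal.ofReal_pos.2 hc |>.ne')) (Or.inl ENNReal.ofReal_ne_top)).1 hL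
    rw [mul_comm]
    exact this.le
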